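/- Model. A base station serves clients $i=1,\dots,M$. Time is divided into frames $k=1,2,\dots$ of $T\ge 1$ slots each. At the beginning of every frame one new packet per client is generated and replaces the undelivered packet of the previous frame. In each slot the station idles or transmits the packet of one client whose packet of the current frame is still undelivered; a transmission to client $i$ succeeds with probability $p_i\in(0,1]$, independently of the past, and the outcome is fed back at once. An admissible policy $\pi\in\Pi$ chooses, possibly at random, on the basis of all past decisions and outcomes only. Let $h_{1,i}\ge 1$ be given integers, and let $h_{k+1,i}=1$ if client $i$ receives its packet in frame $k$ and $h_{k+1,i}=h_{k,i}+1$ otherwise. With weights $\alpha_i>0$ put $$J_K^\pi=\frac1{KM}\sum_{k=1}^K\sum_{i=1}^M\alpha_i h_{k,i}^\pi .$$ A Greedy policy $G$ transmits in every slot to a client with the highest value of $h_{k,i}$ among those with an undelivered packet (ties broken arbitrarily) and idles only if no packet is undelivered. The infinite-horizon optimality ratio of a policy $\pi$ is $$\psi^\pi=\frac{\limsup_{K\to\infty}\mathbb E[J_K^\pi]}{\liminf_{K\to\infty}\inf_{\eta\in\Pi}\mathbb E[J_K^\eta]} .$$ Theorem (Performance of Greedy). In the infinite-horizon limit and as $M\to\infty$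 with $T$ fixed, Greedy is $\rho^G$-optimal, where $$\rho^G=\frac{\left(\sum_{i=1}^M\alpha_i\right)\left(\sum_{i=1}^M\frac1{p_i}\right)\left[1+\frac{C_V^2}{M}\right]+T\sum_{i=1}^M\alpha_i}{\left(\sum_{i=1}^M\sqrt{\alpha_i/p_i}\right)^2+T\sum_{i=1}^M\alpha_i}$$ and $C_V=\sqrt{\bar V}/\bar m$ with $\bar m=\frac1M\sum_{j}\frac1{p_j}$ and $\bar V=\frac1M\sum_{j}\left(\frac1{p_j}-\bar m\right)^2$. That is: for every $T\ge1$ and every $\varepsilon>0$ there is $M_0$ such that for every $M\ge M_0$, all $p_i\in(0,1]$, all $\alpha_i>0$, all initial integers $h_{1,i}\ge1$ and every Greedy policy $G$, $$\psi^G\le(1+\varepsilon)\,\rho^G .$$ -/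

import Mathlib

namespace AoI

open scoped ENNReal

/-- A network with `M` clients and frames of `T` slots: channel reliabilities `p i ∈ (0, 1]` and
positive client weights `α i`. -/
structure Network (M T : ℕ) where
  p : Fin M → ℝ
  p_pos : ∀ i, 0 < p i
  p_le_one : ∀ i, p i ≤ 1
  α : Fin M → ℝ
  α_pos : ∀ i, 0 < α i

/-- What the base station sees in one slot: the selected client (`none` means idling) and the
feedback (`true` means that the packet was delivered). -/
abbrev SlotRecord (M : ℕ) : Type := Option (Fin M) × Bool

/-- The records of all past slots, oldest first. -/
abbrev History (M : ℕ) : Type := List (SlotRecord M)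

/-- A non-anticipative (possibly randomized and history dependent) scheduling rule: the
distribution of the next decision, given all past decisions and feedback. -/
abbrev Policy (M : ℕ) : Type := History M → PMF (Option (Fin M))

/-- State of the network at the beginning of a slot. -/
structure State (M : ℕ) where
  /-- `h_{k,i}` for the current frame `k`. -/
  age : Fin M → ℕ
  /-- Clients whose packet of the current frame has already been delivered. -/
  delivered : Finset (Fin M)
  /-- Number of slots of the current frame that are over. -/
  elapsed : ℕ

/-- The clients served in the current frame, once the record of one more slot is known. -/
def deliveredAfter {M : ℕ} (s : State M) : SlotRecord M → Finset (Fin M)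
  | (some i, true) => insert i s.delivered
  | _ => s.delivered

/-- Evolution over one slot. At the end of the last slot of a frame the ages are updated
(`1` for a client that received its packet in the frame, plus one for the others), and new
packets replace the old ones. -/
def slotStep {M : ℕ} (T : ℕ) (s : State M) (x : SlotRecord M) : State M :=
  if s.elapsed + 1 = T then
    { age := fun i => if i ∈ deliveredAfter s x then 1 else s.age i + 1
      delivered := ∅
      elapsed := 0 }
  else
    { age := s.age
      delivered := deliveredAfter s x
      elapsed := s.elapsed + 1 }

/-- The state that a history leads to, from the initial vector `h₁` at the start of frame 1. -/
def stateAfter {M : ℕ} (T : ℕ) (h₁ : Fin M → ℕ) (w : History M) : State M :=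
  w.foldl (slotStep T) { age := h₁, delivered := ∅, elapsed := 0 }

/-- Admissible policies idle or select a client with an undelivered packet. -/
def IsAdmissible {M : ℕ} (T : ℕ) (h₁ : Fin M → ℕ) (π : Policy M) : Prop :=
  ∀ (w : History M) (i : Fin M), some i ∈ (π w).support → i ∉ (stateAfter T h₁ w).delivered

/-- Greedy policies: in each slot, select a client of highest age among those with an undelivered
packet, and idle only if no packet is left. Ties are broken arbitrarily: every rule for
breaking them, even a randomized and history dependent one, gives a policy of this kind. -/
def IsGreedy {M : ℕ} (T : ℕ) (h₁ : Fin M → ℕ) (π : Policy M) : Prop :=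
  ∀ w : History M,
    (∀ i : Fin M, some i ∈ (π w).support →
      i ∉ (stateAfter T h₁ w).delivered ∧
      ∀ j : Fin M, j ∉ (stateAfter T h₁ w).delivered →
        (stateAfter T h₁ w).age j ≤ (stateAfter T h₁ w).age i) ∧
    (none ∈ (π w).support → ∀ j : Fin M, j ∈ (stateAfter T h₁ w).delivered)

/-- Distribution of the feedback: a transmission to client `i` succeeds with probability `p i`. -/
noncomputable def feedback {M T : ℕ} (N : Network M T) : Option (Fin M) → PMF Bool
  | none => PMF.pure false
  | some i =>
      PMF.ofFintype (fun b => if b then ENNReal.ofReal (N.p i) else ENNReal.ofReal (1 - N.p i)) (by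
        have h := ENNReal.ofReal_add (N.p_pos i).le (sub_nonneg.2 (N.p_le_one i))
        simp [← h])

/-- Law of the history of the first `t` slots under the policy `π`. -/
noncomputable def law {M T : ℕ} (N : Network M T) (π : Policy M) : ℕ → PMF (History M)
  | 0 => PMF.pure []
  | t + 1 =>
      (law N π t).bind fun w =>
        (π w).bind fun a =>
          (feedback N a).bind fun b => PMF.pure (w ++ [(a, b)])

/-- `J_K`, the weighted sum of ages `(1 / (K M)) ∑_{k ≤ K} ∑_i α_i h_{k,i}`, on a history of `K T`
slots. The summand with index `k` belongs to frame `k + 1`, which starts after `k T` slots. -/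
noncomputable def cost {M T : ℕ} (N : Network M T) (h₁ : Fin M → ℕ) (K : ℕ) (w : History M) : ℝ :=
  1 / ((K : ℝ) * (M : ℝ)) *
    ∑ k ∈ Finset.range K, ∑ i : Fin M, N.α i * ((stateAfter T h₁ (w.take (k * T))).age i : ℝ)

/-- `E[J_K^π]`. -/
noncomputable def expectedCost {M T : ℕ} (N : Network M T) (h₁ : Fin M → ℕ) (π : Policy M)
    (K : ℕ) : ℝ≥0∞ :=
  ∑' w : History M, law N π (K * T) w * ENNReal.ofReal (cost N h₁ K w)

/-- `E[J*]` at horizon `K`: the infimum of `E[J_K^η]` over all admissible policies `η`. -/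
noncomputable def optimalCost {M T : ℕ} (N : Network M T) (h₁ : Fin M → ℕ) (K : ℕ) : ℝ≥0∞ :=
  ⨅ η : {η : Policy M // IsAdmissible T h₁ η}, expectedCost N h₁ η.1 K

/-- The optimality ratio of `π` in the limit of an infinite horizon. The upper limit is taken for
the policy and the lower limit for the optimum, so that a bound on this ratio holds for every
way of passing to the limit. -/
noncomputable def optimalityRatio {M T : ℕ} (N : Network M T) (h₁ : Fin M → ℕ) (π : Policy M) :
    ℝ≥0∞ :=
  Filter.limsup (fun K => expectedCost N h₁ π K) Filter.atTop /
    Filter.liminf (fun K => optimalCost N h₁ K) Filter.atTop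

/-- Sample mean of `1 / p i`. -/
noncomputable def meanInv {M T : ℕ} (N : Network M T) : ℝ :=
  1 / (M : ℝ) * ∑ j : Fin M, 1 / N.p j

/-- Sample variance of `1 / p i`. -/
noncomputable def varInv {M T : ℕ} (N : Network M T) : ℝ :=
  1 / (M : ℝ) * ∑ j : Fin M, (1 / N.p j - meanInv N) ^ 2

/-- Coefficient of variation of `1 / p i`. -/
noncomputable def coeffVar {M T : ℕ} (N : Network M T) : ℝ :=
  Real.sqrt (varInv N) / meanInv N

/-- The performance guarantee `ρ^G`. -/
noncomputable def rhoGreedy {M T : ℕ} (N : Network M T) : ℝ :=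
  ((∑ i : Fin M, N.α i) * (∑ i : Fin M, 1 / N.p i) * (1 + coeffVar N ^ 2 / (M : ℝ)) +
      (T : ℝ) * ∑ i : Fin M, N.α i) /
    ((∑ i : Fin M, Real.sqrt (N.α i / N.p i)) ^ 2 + (T : ℝ) * ∑ i : Fin M, N.α i)

end AoI

/-! Write S for the sum of the 1/p_k, Q for the sum of their squares, A for the sum of the weights,
and D_i for the number of deliveries to client i. One fact serves both bounds: a transmission to j
raises the sum of D_j/p_j by 1 on average, so after t slots this sum has mean at most t
(`mean_sum_deliveries_le`).

Lower bound, for any policy. A gap of τ frames between deliveries costs τ(τ+1)/2 in age, and τ² ≥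
2xτ - x² for every x. Hence the age sum of a client is bounded below by a linear function of time
and D_i on every sample path (`le_ageSum`). The slope x_i is chosen so that the weighted D_i combine
into a multiple of the sum of D_i/p_i; taking means gives `optimalBound`.

Upper bound, for Greedy. Greedy is almost round-robin: frame ends create ties only among the at most
T clients just served, so the D_i are proportional up to factors M ± T
(`mul_deliveries_le_mul_deliveries`), and E[D_i] is at most about t/S (`mean_deliveries_le`). While
i waits, the clients ahead of it are served one by one in geometric times. The second moment of the
total waiting time bounds the mean cost of a cycle by `cycleCost`, which is (S² + Q)/2 plus terms of
order TS + T². A supermartingale that pays `cycleCost` at each delivery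
(`stepMean_compensatedAge_le`) makes this rigorous without any renewal or stationarity argument.

Finally S + Q/S agrees with S(1 + C_V²/M) up to a factor 1/(1 - 1/M), and S ≥ M turns the additive
errors in T into relative errors of order T/M, uniformly in p and α (`greedyBound_le`). -/

namespace AoI

open scoped ENNReal

/-! ### Expectations over finite histories -/

variable {M T : ℕ}

/-- Expectation of a function of the history after one more slot, given the history so far. -/
noncomputable def stepMean (N : Network M T) (π : Policy M) :
    (History M → ℝ) →ₗ[ℝ] (History M → ℝ) where
  toFun f w := ∑ a, (π w a).toReal * ∑ b, (feedback N a b).toReal * f (w ++ [(a, b)])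
  map_add' f g := by
    funext w
    simp only [Pi.add_apply, mul_add, Finset.sum_add_distrib]
  map_smul' r f := by
    funext w
    simp only [Pi.smul_apply, smul_eq_mul, RingHom.id_apply, Finset.mul_sum]
    refine Finset.sum_congr rfl fun a _ => Finset.sum_congr rfl fun b _ => ?_
    ring

theorem stepMean_apply (N : Network M T) (π : Policy M) (f : History M → ℝ) (w : History M) :
    stepMean N π f w = ∑ a, (π w a).toReal * ∑ b, (feedback N a b).toReal * f (w ++ [(a, b)]) :=
  rfl

/-- Expectation of a function of the history of the first `t` slots. -/
noncomputable def mean (N : Network M T) (π : Policy M) : ℕ → (History M → ℝ) →ₗ[ℝ] ℝ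
  | 0 => LinearMap.proj []
  | t + 1 => (mean N π t).comp (stepMean N π)

/-- Histories that occur with positive probability. -/
inductive IsPath (N : Network M T) (π : Policy M) : History M → Prop
  | nil : IsPath N π []
  | snoc (w : History M) (a : Option (Fin M)) (b : Bool) : IsPath N π w → a ∈ (π w).support →
      b ∈ (feedback N a).support → IsPath N π (w ++ [(a, b)])

theorem sum_toReal_eq_one {β : Type*} [Fintype β] (q : PMF β) : ∑ a, (q a).toReal = 1 := by
  rw [← ENNReal.toReal_sum fun a _ => q.apply_ne_top a, ← tsum_fintype (L := .unconditional _),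
    q.tsum_coe, ENNReal.toReal_one]

theorem tsum_bind_mul {β γ : Type*} (q : PMF β) (g : β → PMF γ) (F : γ → ℝ≥0∞) :
    ∑' c, q.bind g c * F c = ∑' b, q b * ∑' c, g b c * F c := by
  simp only [PMF.bind_apply, ← ENNReal.tsum_mul_right, ← ENNReal.tsum_mul_left]
  rw [ENNReal.tsum_comm]
  simp only [mul_assoc]

theorem tsum_pure_mul {γ : Type*} (c : γ) (F : γ → ℝ≥0∞) :
    ∑' c', PMF.pure c c' * F c' = F c := by
  rw [tsum_eq_single c]
  · simp
  · intro b hb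
    simp [PMF.pure_apply, hb]

theorem stepMean_nonneg {N : Network M T} {π : Policy M} {f : History M → ℝ} (hf : ∀ w, 0 ≤ f w)
    (w : History M) : 0 ≤ stepMean N π f w := by
  rw [stepMean_apply]
  refine Finset.sum_nonneg fun a _ => mul_nonneg ENNReal.toReal_nonneg <|
    Finset.sum_nonneg fun b _ => mul_nonneg ENNReal.toReal_nonneg (hf _)

/-- Replaces the extended nonnegative expectation by the real linear functional `mean`, on which
subtraction and linear arithmetic are available. -/
theorem tsum_law_mul_ofReal (N : Network M T) (π : Policy M) (t : ℕ) (f : History M → ℝ)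
    (hf : ∀ w, 0 ≤ f w) :
    ∑' w, law N π t w * ENNReal.ofReal (f w) = ENNReal.ofReal (mean N π t f) := by
  induction t generalizing f with
  | zero => simp [law, mean]
  | succ t ih =>
    have key : ∀ w, ∑' c, ((π w).bind fun a => (feedback N a).bind fun b =>
        PMF.pure (w ++ [(a, b)])) c * ENNReal.ofReal (f c) =
        ENNReal.ofReal (stepMean N π f w) := by
      intro w
      simp only [tsum_bind_mul, tsum_pure_mul, tsum_fintype, stepMean_apply]
      have hn : ∀ a b, 0 ≤ (feedback N a b).toReal * f (w ++ [(a, b)]) := fun a b =>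
        mul_nonneg ENNReal.toReal_nonneg (hf _)
      rw [ENNReal.ofReal_sum_of_nonneg fun a _ =>
        mul_nonneg ENNReal.toReal_nonneg (Finset.sum_nonneg fun b _ => hn a b)]
      refine Finset.sum_congr rfl fun a _ => ?_
      rw [ENNReal.ofReal_mul ENNReal.toReal_nonneg, ENNReal.ofReal_toReal (PMF.apply_ne_top _ _),
        ENNReal.ofReal_sum_of_nonneg fun b _ => hn a b]
      congr 1
      refine Finset.sum_congr rfl fun b _ => ?_
      rw [ENNReal.ofReal_mul ENNReal.toReal_nonneg, ENNReal.ofReal_toReal (PMF.apply_ne_top _ _)]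
    rw [law, tsum_bind_mul]
    simp only [key]
    rw [ih _ (stepMean_nonneg hf)]
    rfl

theorem stepMean_mono_of_support {N : Network M T} {π : Policy M} {f g : History M → ℝ}
    {w : History M}
    (h : ∀ a ∈ (π w).support, ∑ b, (feedback N a b).toReal * f (w ++ [(a, b)]) ≤
      ∑ b, (feedback N a b).toReal * g (w ++ [(a, b)])) :
    stepMean N π f w ≤ stepMean N π g w := by
  rw [stepMean_apply, stepMean_apply]
  refine Finset.sum_le_sum fun a _ => ?_
  by_cases ha : a ∈ (π w).support
  · exact mul_le_mul_of_nonneg_left (h a ha) ENNReal.toReal_nonneg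
  · have : π w a = 0 := by simpa [PMF.mem_support_iff] using ha
    simp [this]

theorem stepMean_le_of_support {N : Network M T} {π : Policy M} {f : History M → ℝ}
    {w : History M} {c : ℝ}
    (h : ∀ a ∈ (π w).support, ∑ b, (feedback N a b).toReal * f (w ++ [(a, b)]) ≤ c) :
    stepMean N π f w ≤ c := by
  have h1 : stepMean N π f w ≤ stepMean N π (fun _ => c) w := by
    refine stepMean_mono_of_support fun a ha => ?_
    rw [← Finset.sum_mul, sum_toReal_eq_one, one_mul]
    exact h a ha
  refine h1.trans (le_of_eq ?_)
  simp only [stepMean_apply, ← Finset.sum_mul, sum_toReal_eq_one, one_mul]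

theorem mean_mono {N : Network M T} {π : Policy M} {t : ℕ} {f g : History M → ℝ}
    (h : ∀ w, IsPath N π w → w.length = t → f w ≤ g w) : mean N π t f ≤ mean N π t g := by
  induction t generalizing f g with
  | zero => exact h [] .nil rfl
  | succ t ih =>
    refine ih fun w hw hl => stepMean_mono_of_support fun a ha => ?_
    refine Finset.sum_le_sum fun b _ => ?_
    by_cases hb : b ∈ (feedback N a).support
    · exact mul_le_mul_of_nonneg_left (h _ (.snoc w a b hw ha hb) (by simp [hl]))
        ENNReal.toReal_nonneg
    · have : feedback N a b = 0 := by simpa [PMF.mem_support_iff] using hb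
      simp [this]

theorem mean_const (N : Network M T) (π : Policy M) (t : ℕ) (c : ℝ) :
    mean N π t (fun _ => c) = c := by
  induction t with
  | zero => rfl
  | succ t ih =>
    have : stepMean N π (fun _ => c) = fun _ => c := by
      funext w
      simp only [stepMean_apply, ← Finset.sum_mul, sum_toReal_eq_one, one_mul]
    rw [mean, LinearMap.comp_apply, this, ih]

/-- The expectation of a supermartingale does not exceed its initial value. -/
theorem mean_le_of_stepMean_le {N : Network M T} {π : Policy M} {f : History M → ℝ}
    (h : ∀ w, IsPath N π w → stepMean N π f w ≤ f w) (t : ℕ) : mean N π t f ≤ f [] := by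
  induction t with
  | zero => exact le_rfl
  | succ t ih => exact (mean_mono fun w hw _ => h w hw).trans ih

theorem sum_feedback_none (N : Network M T) (f : Bool → ℝ) :
    ∑ b, (feedback N none b).toReal * f b = f false := by
  simp [feedback]

theorem sum_feedback_some (N : Network M T) (i : Fin M) (f : Bool → ℝ) :
    ∑ b, (feedback N (some i) b).toReal * f b = N.p i * f true + (1 - N.p i) * f false := by
  simp [feedback, ENNReal.toReal_ofReal (N.p_pos i).le,
    ENNReal.toReal_ofReal (sub_nonneg.2 (N.p_le_one i))]

/-! ### Deliveries, age sums and invariants of the state -/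

theorem stateAfter_snoc (T : ℕ) (h₁ : Fin M → ℕ) (w : History M) (x : SlotRecord M) :
    stateAfter T h₁ (w ++ [x]) = slotStep T (stateAfter T h₁ w) x := by
  simp [stateAfter]

/-- Number of deliveries to client `i`. -/
def deliveries (i : Fin M) (w : History M) : ℕ := w.count (some i, true)

/-- Sum over all slots of the age of client `i`. -/
def ageSum (T : ℕ) (h₁ : Fin M → ℕ) (i : Fin M) (w : History M) : ℕ :=
  ∑ t ∈ Finset.range w.length, (stateAfter T h₁ (w.take t)).age i

theorem deliveries_snoc (i : Fin M) (w : History M) (x : SlotRecord M) :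
    deliveries i (w ++ [x]) = deliveries i w + if x = (some i, true) then 1 else 0 := by
  simp [deliveries, List.count_append, List.count_singleton]

theorem ageSum_snoc (T : ℕ) (h₁ : Fin M → ℕ) (i : Fin M) (w : History M) (x : SlotRecord M) :
    ageSum T h₁ i (w ++ [x]) = ageSum T h₁ i w + (stateAfter T h₁ w).age i := by
  simp only [ageSum, List.length_append, List.length_singleton, Finset.sum_range_succ]
  congr 1
  · refine Finset.sum_congr rfl fun t ht => ?_
    rw [List.take_append_of_le_length (Finset.mem_range.1 ht).le]
  · simp

theorem elapsed_stateAfter (hT : 0 < T) (h₁ : Fin M → ℕ) (w : History M) :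
    (stateAfter T h₁ w).elapsed = w.length % T := by
  induction w using List.reverseRecOn with
  | nil => simp [stateAfter]
  | append_singleton w x ih =>
    have h1 := Nat.mod_lt w.length hT
    rw [stateAfter_snoc, slotStep, List.length_append, List.length_singleton, Nat.add_mod]
    split_ifs with h
    · rw [ih] at h
      rcases Nat.lt_or_ge 1 T with h2 | h2
      · simp [Nat.mod_eq_of_lt h2, h]
      · obtain rfl : T = 1 := by omega
        simp [Nat.mod_one]
    · rw [ih] at h
      rw [Nat.mod_eq_of_lt (a := 1) (by omega), Nat.mod_eq_of_lt (by omega)]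
      simp [ih]

theorem age_take_add (hT : 0 < T) (h₁ : Fin M → ℕ) (w : History M) (k r : ℕ) (hr : r < T)
    (hl : k * T + r ≤ w.length) :
    (stateAfter T h₁ (w.take (k * T + r))).age = (stateAfter T h₁ (w.take (k * T))).age := by
  induction r with
  | zero => rfl
  | succ r ih =>
    have h1 : k * T + r < w.length := by omega
    rw [← add_assoc, List.take_succ_eq_append_getElem h1, stateAfter_snoc, slotStep, if_neg,
      ih (by omega) (by omega)]
    rw [elapsed_stateAfter hT, List.length_take, min_eq_left h1.le, Nat.add_comm (k * T),
      Nat.add_mul_mod_self_right, Nat.mod_eq_of_lt (by omega)]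
    omega

theorem ageSum_eq (hT : 0 < T) (h₁ : Fin M → ℕ) (i : Fin M) (w : History M) (K : ℕ)
    (hw : w.length = K * T) :
    ageSum T h₁ i w = T * ∑ k ∈ Finset.range K, (stateAfter T h₁ (w.take (k * T))).age i := by
  have key : ∀ k, k ≤ K → ∑ t ∈ Finset.range (k * T), (stateAfter T h₁ (w.take t)).age i =
      T * ∑ k ∈ Finset.range k, (stateAfter T h₁ (w.take (k * T))).age i := by
    intro k hk
    induction k with
    | zero => simp
    | succ k ih =>
      rw [Nat.succ_mul, Finset.sum_range_add, ih (by omega), Finset.sum_range_succ, mul_add]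
      congr 1
      rw [Finset.sum_congr rfl fun r hr => ?_, Finset.sum_const, Finset.card_range, smul_eq_mul]
      have h1 : (k + 1) * T ≤ K * T := Nat.mul_le_mul_right T hk
      have h2 := Finset.mem_range.1 hr
      rw [age_take_add hT h₁ w k r h2 (by rw [hw]; rw [Nat.succ_mul] at h1; omega)]
  rw [ageSum, hw, key K le_rfl]

theorem one_le_age {h₁ : Fin M → ℕ} (hh : ∀ i, 1 ≤ h₁ i) (w : History M) (i : Fin M) :
    1 ≤ (stateAfter T h₁ w).age i := by
  induction w using List.reverseRecOn with
  | nil => exact hh i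
  | append_singleton w x ih =>
    rw [stateAfter_snoc, slotStep]
    split_ifs
    · dsimp only
      split_ifs <;> omega
    · exact ih

theorem elapsed_lt (hT : 0 < T) (h₁ : Fin M → ℕ) (w : History M) :
    (stateAfter T h₁ w).elapsed < T := by
  rw [elapsed_stateAfter hT]
  exact Nat.mod_lt _ hT

theorem card_deliveredAfter_le (s : State M) (x : SlotRecord M) :
    (deliveredAfter s x).card ≤ s.delivered.card + 1 := by
  rcases x with ⟨_ | j, _ | _⟩ <;> simp [deliveredAfter, Finset.card_insert_le]

theorem card_delivered_le (h₁ : Fin M → ℕ) (w : History M) :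
    (stateAfter T h₁ w).delivered.card ≤ (stateAfter T h₁ w).elapsed := by
  induction w using List.reverseRecOn with
  | nil => simp [stateAfter]
  | append_singleton w x ih =>
    have := card_deliveredAfter_le (stateAfter T h₁ w) x
    rw [stateAfter_snoc, slotStep]
    split_ifs
    · simp
    · dsimp only
      omega

/-- Total number of deliveries. -/
def totalDeliveries (w : History M) : ℕ := ∑ i, deliveries i w

theorem totalDeliveries_snoc_delivery (w : History M) (j : Fin M) :
    totalDeliveries (w ++ [(some j, true)]) = totalDeliveries w + 1 := by
  simp [totalDeliveries, deliveries_snoc, Finset.sum_add_distrib]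

theorem feedback_none_support {N : Network M T} {b : Bool} (hb : b ∈ (feedback N none).support) :
    b = false := by
  simpa [feedback] using hb

/-- Slots without delivery leave counts and the set of delivered packets unchanged. -/
theorem eq_delivery_or {N : Network M T} {a : Option (Fin M)} {b : Bool}
    (hb : b ∈ (feedback N a).support) :
    (∃ j, a = some j ∧ b = true) ∨
      ((∀ s : State M, deliveredAfter s (a, b) = s.delivered) ∧
        (∀ (i : Fin M) (w : History M), deliveries i (w ++ [(a, b)]) = deliveries i w) ∧
        ∀ w : History M, totalDeliveries (w ++ [(a, b)]) = totalDeliveries w) := by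
  rcases a with _ | j
  · obtain rfl := feedback_none_support hb
    exact .inr ⟨fun _ => rfl, by simp [deliveries_snoc],
      by simp [totalDeliveries, deliveries_snoc]⟩
  · cases b
    · exact .inr ⟨fun _ => rfl, by simp [deliveries_snoc],
        by simp [totalDeliveries, deliveries_snoc]⟩
    · exact .inl ⟨j, rfl, rfl⟩

/-! ### Greedy is nearly round-robin -/

section slotStep

variable {s : State M} {x : SlotRecord M} {i : Fin M}

theorem notMem_delivered_slotStep (hi : i ∉ deliveredAfter s x) :
    i ∉ (slotStep T s x).delivered := by
  rw [slotStep]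
  split_ifs
  · simp
  · exact hi

/-- A frame end gives served clients age 1 and raises all others by one. The order relative to an
unserved client therefore survives if served clients count as lowest, which is the role of the
disjunct with `delivered`. -/
theorem age_slotStep_le_iff (hi : i ∉ deliveredAfter s x) (k : Fin M) :
    (k ∈ (slotStep T s x).delivered ∨ (slotStep T s x).age k ≤ (slotStep T s x).age i) ↔
      (k ∈ deliveredAfter s x ∨ s.age k ≤ s.age i) := by
  rw [slotStep]
  split_ifs
  · by_cases hk : k ∈ deliveredAfter s x <;> simp [hk, hi]
  · rfl

theorem age_slotStep_lt_iff (hi : i ∉ deliveredAfter s x) (h1 : 1 ≤ s.age i) (k : Fin M) :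
    (k ∈ (slotStep T s x).delivered ∨ (slotStep T s x).age k < (slotStep T s x).age i) ↔
      (k ∈ deliveredAfter s x ∨ s.age k < s.age i) := by
  rw [slotStep]
  split_ifs
  · by_cases hk : k ∈ deliveredAfter s x <;> simp [hk, hi]
    omega
  · rfl

theorem slotStep_of_lt (h : s.elapsed + 1 < T) :
    slotStep T s x = ⟨s.age, deliveredAfter s x, s.elapsed + 1⟩ := by
  rw [slotStep, if_neg h.ne]

theorem slotStep_of_eq (h : s.elapsed + 1 = T) :
    slotStep T s x = ⟨fun i => if i ∈ deliveredAfter s x then 1 else s.age i + 1, ∅, 0⟩ := by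
  rw [slotStep, if_pos h]

end slotStep

/-- Clients that are served no earlier than `i` in the current round, ties included. -/
def weaklyBehind (s : State M) (i : Fin M) : Finset (Fin M) :=
  Finset.univ.filter fun k => k ∈ s.delivered ∨ s.age k ≤ s.age i

/-- Clients that are served later than `i`. -/
def behind (s : State M) (i : Fin M) : Finset (Fin M) :=
  Finset.univ.filter fun k => k ∈ s.delivered ∨ s.age k < s.age i

theorem weaklyBehind_slotStep {s : State M} {x : SlotRecord M} {i : Fin M}
    (hi : i ∉ deliveredAfter s x) : weaklyBehind (slotStep T s x) i =
      Finset.univ.filter fun k => k ∈ deliveredAfter s x ∨ s.age k ≤ s.age i :=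
  Finset.filter_congr fun k _ => age_slotStep_le_iff hi k

theorem behind_slotStep {s : State M} {x : SlotRecord M} {i : Fin M}
    (hi : i ∉ deliveredAfter s x) (h1 : 1 ≤ s.age i) : behind (slotStep T s x) i =
      Finset.univ.filter fun k => k ∈ deliveredAfter s x ∨ s.age k < s.age i :=
  Finset.filter_congr fun k _ => age_slotStep_lt_iff hi h1 k

/-- Between two deliveries to a client, Greedy serves at least `M - T` packets. -/
theorem mul_deliveries_le {N : Network M T} {h₁ : Fin M → ℕ} {G : Policy M} (hT : 0 < T)
    (hh : ∀ i, 1 ≤ h₁ i) (hG : IsGreedy T h₁ G) (i : Fin M) {w : History M} (hw : IsPath N G w) :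
    (i ∉ (stateAfter T h₁ w).delivered →
      M * deliveries i w + (weaklyBehind (stateAfter T h₁ w) i).card ≤
        totalDeliveries w + T * deliveries i w + M) ∧
    (i ∈ (stateAfter T h₁ w).delivered →
      M * deliveries i w + T ≤ totalDeliveries w + T * deliveries i w + M) := by
  induction hw with
  | nil =>
    refine ⟨fun _ => ?_, fun h => by simp [stateAfter] at h⟩
    have := Finset.card_le_univ (weaklyBehind (stateAfter T h₁ []) i)
    simp [deliveries, totalDeliveries] at this ⊢
    exact this
  | snoc w a b hw ha hb ih =>
    have hage := one_le_age (T := T) hh w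
    have hel := elapsed_lt hT h₁ w
    have hcard := card_delivered_le (T := T) h₁ w
    have hdel := card_deliveredAfter_le (stateAfter T h₁ w) (a, b)
    rw [stateAfter_snoc]
    generalize hs : stateAfter T h₁ w = s at *
    -- The invariant after the feedback but before a possible frame end; the frame end is treated
    -- separately below.
    have main : (i ∉ deliveredAfter s (a, b) → M * deliveries i (w ++ [(a, b)]) +
          (Finset.univ.filter fun k => k ∈ deliveredAfter s (a, b) ∨ s.age k ≤ s.age i).card ≤
          totalDeliveries (w ++ [(a, b)]) + T * deliveries i (w ++ [(a, b)]) + M) ∧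
        (i ∈ deliveredAfter s (a, b) → M * deliveries i (w ++ [(a, b)]) + T ≤
          totalDeliveries (w ++ [(a, b)]) + T * deliveries i (w ++ [(a, b)]) + M) := by
      rcases eq_delivery_or hb with ⟨j, rfl, rfl⟩ | ⟨h1, h2, h3⟩
      · obtain ⟨hj, hmax⟩ := (hG w).1 j ha
        rw [hs] at hj hmax
        rw [totalDeliveries_snoc_delivery, deliveries_snoc]
        by_cases hij : i = j
        · subst hij
          -- When Greedy serves i, every client is weakly behind it, so the set has grown to its
          -- full size M.
          have huniv : weaklyBehind s i = Finset.univ := by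
            refine Finset.filter_true_of_mem fun k _ => ?_
            by_cases hk : k ∈ s.delivered
            · exact .inl hk
            · exact .inr (hmax k hk)
          have := ih.1 hj
          rw [huniv, Finset.card_univ, Fintype.card_fin] at this
          refine ⟨fun h => absurd (Finset.mem_insert_self _ _) h, fun _ => ?_⟩
          simp only [if_true, mul_add]
          omega
        · have hne : ((some j, true) : SlotRecord M) ≠ (some i, true) := by
            simpa using fun h => hij h.symm
          rw [if_neg hne, add_zero]
          have hmem : i ∈ deliveredAfter s (some j, true) ↔ i ∈ s.delivered := by
            simp [deliveredAfter, hij]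
          rw [hmem]
          refine ⟨fun h => ?_, fun h => by have := ih.2 h; omega⟩
          -- Only an inclusion: j may tie with i and already be weakly behind it.
          have hsub : (Finset.univ.filter fun k => k ∈ deliveredAfter s (some j, true) ∨
              s.age k ≤ s.age i) ⊆ insert j (weaklyBehind s i) := by
            intro k hk
            simp only [deliveredAfter, weaklyBehind, Finset.mem_filter, Finset.mem_univ, true_and,
              Finset.mem_insert] at hk ⊢
            tauto
          have := (Finset.card_le_card hsub).trans (Finset.card_insert_le _ _)
          have := ih.1 h
          omega
      · rw [h1, h2, h3]
        exact ih
    by_cases hi : i ∈ deliveredAfter s (a, b)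
    · have h0 := main.2 hi
      rcases Nat.lt_or_ge (s.elapsed + 1) T with he | he
      · rw [slotStep_of_lt he]
        exact ⟨fun h => absurd hi h, main.2⟩
      · have he : s.elapsed + 1 = T := by omega
        refine ⟨fun _ => ?_, fun h => by simp [slotStep_of_eq he] at h⟩
        -- Now i has age 1 and unserved clients have age at least 2, so only clients of the same
        -- frame, at most T of them, tie with i. This is the loss of T per cycle.
        have hsub : weaklyBehind (slotStep T s (a, b)) i ⊆ deliveredAfter s (a, b) := by
          intro k hk
          by_contra hk'
          have := hage k
          simp [weaklyBehind, slotStep_of_eq he, hi, hk'] at hk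
          omega
        have := Finset.card_le_card hsub
        omega
    · rw [weaklyBehind_slotStep hi]
      exact ⟨fun _ => main.1 hi, fun h => absurd h (notMem_delivered_slotStep hi)⟩

/-- Between two deliveries to a client, Greedy serves at most `M + T` packets. -/
theorem totalDeliveries_le {N : Network M T} {h₁ : Fin M → ℕ} {G : Policy M} (hT : 0 < T)
    (hh : ∀ i, 1 ≤ h₁ i) (hG : IsGreedy T h₁ G) (i : Fin M) {w : History M} (hw : IsPath N G w) :
    (i ∉ (stateAfter T h₁ w).delivered →
      totalDeliveries w ≤ (M + T) * deliveries i w + (behind (stateAfter T h₁ w) i).card) ∧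
    (i ∈ (stateAfter T h₁ w).delivered →
      totalDeliveries w + T ≤ (M + T) * deliveries i w + (stateAfter T h₁ w).elapsed) := by
  induction hw with
  | nil =>
    exact ⟨fun _ => by simp [deliveries, totalDeliveries], fun h => by simp [stateAfter] at h⟩
  | snoc w a b hw ha hb ih =>
    have hage := one_le_age (T := T) hh w i
    have hel := elapsed_lt hT h₁ w
    rw [stateAfter_snoc]
    generalize hs : stateAfter T h₁ w = s at *
    have main : (i ∉ deliveredAfter s (a, b) → totalDeliveries (w ++ [(a, b)]) ≤
          (M + T) * deliveries i (w ++ [(a, b)]) + (Finset.univ.filter fun k =>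
            k ∈ deliveredAfter s (a, b) ∨ s.age k < s.age i).card) ∧
        (i ∈ deliveredAfter s (a, b) → totalDeliveries (w ++ [(a, b)]) + T ≤
          (M + T) * deliveries i (w ++ [(a, b)]) + (s.elapsed + 1)) := by
      rcases eq_delivery_or hb with ⟨j, rfl, rfl⟩ | ⟨h1, h2, h3⟩
      · obtain ⟨hj, hmax⟩ := (hG w).1 j ha
        rw [hs] at hj hmax
        rw [totalDeliveries_snoc_delivery, deliveries_snoc]
        by_cases hij : i = j
        · subst hij
          have := ih.1 hj
          have hc := Finset.card_le_univ (behind s i)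
          rw [Fintype.card_fin] at hc
          refine ⟨fun h => absurd (Finset.mem_insert_self _ _) h, fun _ => ?_⟩
          simp only [if_true, mul_add]
          omega
        · have hne : ((some j, true) : SlotRecord M) ≠ (some i, true) := by
            simpa using fun h => hij h.symm
          rw [if_neg hne, add_zero]
          have hmem : i ∈ deliveredAfter s (some j, true) ↔ i ∈ s.delivered := by
            simp [deliveredAfter, hij]
          rw [hmem]
          refine ⟨fun h => ?_, fun h => by have := ih.2 h; omega⟩
          have hji := hmax i h
          -- Greedy chose j, so j is not younger than the waiting client i: each delivery adds a new
          -- element to `behind`, which has at most M.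
          have hnot : j ∉ behind s i := by simp [behind, hj, hji]
          have heq : (Finset.univ.filter fun k => k ∈ deliveredAfter s (some j, true) ∨
              s.age k < s.age i) = insert j (behind s i) := by
            ext k
            simp only [deliveredAfter, behind, Finset.mem_filter, Finset.mem_univ, true_and,
              Finset.mem_insert]
            tauto
          have := ih.1 h
          rw [heq, Finset.card_insert_of_notMem hnot]
          omega
      · rw [h1, h2, h3]
        exact ⟨ih.1, fun h => (ih.2 h).trans (by omega)⟩
    by_cases hi : i ∈ deliveredAfter s (a, b)
    · have h0 := main.2 hi
      rcases Nat.lt_or_ge (s.elapsed + 1) T with he | he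
      · rw [slotStep_of_lt he]
        exact ⟨fun h => absurd hi h, main.2⟩
      -- The frame in which i was served contributes at most T further deliveries; the term
      -- `elapsed` has been counting them, and the count restarts from an arbitrary `behind`.
      · have he : s.elapsed + 1 = T := by omega
        exact ⟨fun _ => by omega, fun h => by simp [slotStep_of_eq he] at h⟩
    · rw [behind_slotStep hi hage]
      exact ⟨fun _ => main.1 hi, fun h => absurd h (notMem_delivered_slotStep hi)⟩

/-- Under Greedy, the numbers of deliveries to two clients are nearly proportional. -/
theorem mul_deliveries_le_mul_deliveries {N : Network M T} {h₁ : Fin M → ℕ} {G : Policy M}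
    (hT : 0 < T) (hh : ∀ i, 1 ≤ h₁ i) (hG : IsGreedy T h₁ G) (i j : Fin M) {w : History M}
    (hw : IsPath N G w) :
    ((M : ℝ) - T) * deliveries i w ≤ (M + T) * deliveries j w + 2 * M := by
  have h1 : M * deliveries i w ≤ totalDeliveries w + T * deliveries i w + M := by
    by_cases h : i ∈ (stateAfter T h₁ w).delivered
    · have := (mul_deliveries_le hT hh hG i hw).2 h
      omega
    · have := (mul_deliveries_le hT hh hG i hw).1 h
      omega
  have h2 : totalDeliveries w ≤ (M + T) * deliveries j w + M := by
    by_cases h : j ∈ (stateAfter T h₁ w).delivered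
    · have := (totalDeliveries_le hT hh hG j hw).2 h
      have := elapsed_lt hT h₁ w
      omega
    · have := (totalDeliveries_le hT hh hG j hw).1 h
      have hc := Finset.card_le_univ (behind (stateAfter T h₁ w) j)
      rw [Fintype.card_fin] at hc
      omega
  have h1' : (M : ℝ) * deliveries i w ≤ totalDeliveries w + T * deliveries i w + M := by
    exact_mod_cast h1
  have h2' : (totalDeliveries w : ℝ) ≤ (M + T) * deliveries j w + M := by
    exact_mod_cast h2
  linarith

/-! ### Expected numbers of deliveries -/

/-- Delivering to client `j` takes `1 / p j` attempts on average. -/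
theorem mean_sum_deliveries_le (N : Network M T) (π : Policy M) (t : ℕ) :
    mean N π t (fun w => ∑ j, (deliveries j w : ℝ) / N.p j) ≤ t := by
  induction t with
  | zero => simp [mean, deliveries]
  | succ t ih =>
    have key : mean N π (t + 1) (fun w => ∑ j, (deliveries j w : ℝ) / N.p j) ≤
        mean N π t ((fun w => ∑ j, (deliveries j w : ℝ) / N.p j) + fun _ => 1) := by
      refine mean_mono fun w _ _ => stepMean_le_of_support fun a _ => ?_
      rcases a with _ | j
      · rw [sum_feedback_none]
        simp [deliveries_snoc]
      · rw [sum_feedback_some]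
        have h1 : ∑ k, (deliveries k (w ++ [(some j, true)]) : ℝ) / N.p k =
            ∑ k, (deliveries k w : ℝ) / N.p k + 1 / N.p j := by
          simp only [deliveries_snoc, Nat.cast_add, add_div, Finset.sum_add_distrib]
          congr 1
          rw [Finset.sum_eq_single j] <;> simp +contextual [eq_comm]
        have h2 : ∑ k, (deliveries k (w ++ [(some j, false)]) : ℝ) / N.p k =
            ∑ k, (deliveries k w : ℝ) / N.p k := by
          simp [deliveries_snoc]
        have := (N.p_pos j).ne'
        rw [h1, h2, Pi.add_apply]
        apply le_of_eq
        field_simp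
        ring
    rw [map_add, mean_const] at key
    push_cast
    linarith

/-- Expected number of deliveries to a client under Greedy. -/
theorem mean_deliveries_le {N : Network M T} {h₁ : Fin M → ℕ} {G : Policy M} (hT : 0 < T)
    (hTM : T < M) (hh : ∀ i, 1 ≤ h₁ i) (hG : IsGreedy T h₁ G) (i : Fin M) (t : ℕ) :
    mean N G t (fun w => (deliveries i w : ℝ)) ≤
      (t * (M + T) / (∑ j, 1 / N.p j) + 2 * M) / (M - T) := by
  have hS : 0 < ∑ j, 1 / N.p j :=
    Finset.sum_pos (fun j _ => one_div_pos.2 (N.p_pos j)) ⟨i, Finset.mem_univ _⟩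
  have hMT : (0 : ℝ) < M - T := sub_pos.2 (by exact_mod_cast hTM)
  -- Near proportionality of i and j, weighted by 1/p_j and summed over j, brings in the sum whose
  -- mean is at most t.
  have h1 : mean N G t (((∑ j, 1 / N.p j) * (M - T)) • fun w => (deliveries i w : ℝ)) ≤
      mean N G t (((M + T : ℝ) • fun w => ∑ j, (deliveries j w : ℝ) / N.p j) +
        fun _ => 2 * M * ∑ j, 1 / N.p j) := by
    refine mean_mono fun w hw _ => ?_
    simp only [Pi.smul_apply, Pi.add_apply, smul_eq_mul, Finset.mul_sum, Finset.sum_mul,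
      ← Finset.sum_add_distrib]
    refine Finset.sum_le_sum fun j _ => ?_
    have := mul_le_mul_of_nonneg_left (mul_deliveries_le_mul_deliveries hT hh hG i j hw)
      (one_div_pos.2 (N.p_pos j)).le
    calc _ = 1 / N.p j * ((M - T) * deliveries i w) := by ring
      _ ≤ _ := this
      _ = _ := by ring
  rw [map_smul, map_add, map_smul, mean_const, smul_eq_mul, smul_eq_mul] at h1
  have h2 := mul_le_mul_of_nonneg_left (mean_sum_deliveries_le N G t)
    (by positivity : (0 : ℝ) ≤ M + T)
  rw [le_div_iff₀ hMT, ← mul_le_mul_iff_of_pos_left hS]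
  calc _ = (∑ j, 1 / N.p j) * (M - T) * mean N G t (fun w => (deliveries i w : ℝ)) := by ring
    _ ≤ (M + T) * t + 2 * M * ∑ j, 1 / N.p j := by linarith
    _ = _ := by
      field_simp

/-! ### A supermartingale for the ages under Greedy -/

/-- Clients that Greedy may still serve before `i`, and `i` itself. -/
def ahead (s : State M) (i : Fin M) : Finset (Fin M) :=
  Finset.univ.filter fun k => k ∉ s.delivered ∧ s.age i ≤ s.age k

theorem ahead_slotStep {s : State M} {x : SlotRecord M} {i : Fin M}
    (hi : i ∉ deliveredAfter s x) (h1 : 1 ≤ s.age i) : ahead (slotStep T s x) i =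
      Finset.univ.filter fun k => k ∉ deliveredAfter s x ∧ s.age i ≤ s.age k := by
  refine Finset.filter_congr fun k _ => ?_
  have := age_slotStep_lt_iff (T := T) hi h1 k
  rw [← not_iff_not] at this
  simpa only [not_or, not_lt] using this

/-- Slots since the start of the frame of the last delivery to `i`, if `i` is not yet served. -/
def slotAge (T : ℕ) (s : State M) (i : Fin M) : ℕ := T * s.age i + s.elapsed

theorem slotAge_slotStep {s : State M} {x : SlotRecord M} {i : Fin M}
    (hi : i ∉ deliveredAfter s x) (he : s.elapsed < T) :
    slotAge T (slotStep T s x) i = slotAge T s i + 1 := by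
  rcases Nat.lt_or_ge (s.elapsed + 1) T with h | h
  · rw [slotStep_of_lt h]
    rfl
  · have h : s.elapsed + 1 = T := by omega
    rw [slotStep_of_eq h]
    simp only [slotAge, if_neg hi, mul_add]
    omega

/-- Bound for the expected sum of slot ages from one delivery to the next one. -/
noncomputable def cycleCost (N : Network M T) : ℝ :=
  T * ((∑ k, 1 / N.p k) + T) + ((∑ k, 1 / N.p k) ^ 2 + ∑ k, (1 / N.p k) ^ 2) / 2

theorem sum_one_div_nonneg (N : Network M T) (R : Finset (Fin M)) : 0 ≤ ∑ k ∈ R, 1 / N.p k :=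
  Finset.sum_nonneg fun k _ => (one_div_pos.2 (N.p_pos k)).le

theorem sum_one_div_sq_nonneg (N : Network M T) (R : Finset (Fin M)) :
    0 ≤ ∑ k ∈ R, (1 / N.p k) ^ 2 :=
  Finset.sum_nonneg fun _ _ => sq_nonneg _

theorem cycleCost_nonneg (N : Network M T) : 0 ≤ cycleCost N := by
  have := sum_one_div_nonneg N Finset.univ
  have := sum_one_div_sq_nonneg N Finset.univ
  rw [cycleCost]
  positivity

/-- Expected sum of slot ages until the clients in `R` are served, at slot age `a`. -/
noncomputable def remainingCost (N : Network M T) (R : Finset (Fin M)) (a : ℝ) : ℝ :=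
  a * ((∑ k ∈ R, 1 / N.p k) + T) + ((∑ k ∈ R, 1 / N.p k) ^ 2 + ∑ k ∈ R, (1 / N.p k) ^ 2) / 2

theorem remainingCost_nonneg (N : Network M T) (R : Finset (Fin M)) {a : ℝ} (ha : 0 ≤ a) :
    0 ≤ remainingCost N R a := by
  have := sum_one_div_nonneg N R
  have := sum_one_div_sq_nonneg N R
  rw [remainingCost]
  positivity

/-- The part a·T is a reserve: it pays for the at most T slots of the frame that remain after the
delivery, during which the age is not yet reset. -/
theorem mul_le_remainingCost (N : Network M T) (R : Finset (Fin M)) {a : ℝ} (ha : 0 ≤ a) :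
    a * T ≤ remainingCost N R a := by
  have h1 := mul_nonneg ha (sum_one_div_nonneg N R)
  have h2 := sum_one_div_sq_nonneg N R
  have h3 := sq_nonneg (∑ k ∈ R, 1 / N.p k)
  rw [remainingCost]
  linarith

/-- A new cycle starts with age 1 at a frame start, hence at slot age T; at worst all clients are
ahead. -/
theorem remainingCost_le_cycleCost (N : Network M T) (R : Finset (Fin M)) :
    remainingCost N R T ≤ cycleCost N := by
  have h0 := sum_one_div_nonneg N R
  have h1 : ∑ k ∈ R, 1 / N.p k ≤ ∑ k, 1 / N.p k :=
    Finset.sum_le_univ_sum_of_nonneg fun k => (one_div_pos.2 (N.p_pos k)).le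
  have h2 : ∑ k ∈ R, (1 / N.p k) ^ 2 ≤ ∑ k, (1 / N.p k) ^ 2 :=
    Finset.sum_le_univ_sum_of_nonneg fun k => sq_nonneg _
  rw [remainingCost, cycleCost]
  gcongr

/-- If X is the number of attempts needed to serve R, the slot ages sum to aX + X(X-1)/2, where E[X]
is the sum of the 1/p_k and X has variance the sum of (1-p_k)/p_k². `remainingCost` exceeds the mean
of this by that sum plus aT, whence the -1 and the +T. Any j in R may be attempted, so the order of
service and the ties are irrelevant. -/
theorem remainingCost_attempt (N : Network M T) {R : Finset (Fin M)} {j : Fin M} (hj : j ∈ R)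
    (a : ℝ) :
    N.p j * remainingCost N (R.erase j) (a + 1) + (1 - N.p j) * remainingCost N R (a + 1) =
      remainingCost N R a - a - 1 + T := by
  have hp := (N.p_pos j).ne'
  simp only [remainingCost]
  rw [← Finset.add_sum_erase R _ hj, ← Finset.add_sum_erase R (fun k => (1 / N.p k) ^ 2) hj]
  field_simp
  ring

/-- Potential of client `i`: bounds the expected sum of its slot ages until the next frame in
which it has just been served, up to a constant cost of one cycle. -/
noncomputable def potential (N : Network M T) (s : State M) (i : Fin M) : ℝ :=
  if i ∈ s.delivered then (T - s.elapsed) * (T * s.age i) + cycleCost N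
  else remainingCost N (ahead s i) (slotAge T s i)

theorem potential_nonneg (N : Network M T) {s : State M} (he : s.elapsed < T) (i : Fin M) :
    0 ≤ potential N s i := by
  rw [potential]
  split_ifs
  · have h1 : (0 : ℝ) ≤ T - s.elapsed := sub_nonneg.2 (by exact_mod_cast he.le)
    have := cycleCost_nonneg N
    positivity
  · exact remainingCost_nonneg N _ (Nat.cast_nonneg _)

theorem potential_slotStep_of_mem (N : Network M T) {s : State M} {x : SlotRecord M} {i : Fin M}
    (he : s.elapsed < T) (hi : i ∈ deliveredAfter s x) :
    potential N (slotStep T s x) i ≤ (T - s.elapsed - 1) * (T * s.age i) + cycleCost N := by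
  rcases Nat.lt_or_ge (s.elapsed + 1) T with h | h
  · rw [slotStep_of_lt h, potential, if_pos hi]
    push_cast
    linarith
  · have h : s.elapsed + 1 = T := by omega
    have h' : (T : ℝ) - s.elapsed - 1 = 0 := by
      rw [← h]
      push_cast
      ring
    rw [h', zero_mul, zero_add, slotStep_of_eq h, potential, if_neg (by simp)]
    simpa [slotAge, hi] using remainingCost_le_cycleCost N _

theorem potential_slotStep_of_notMem (N : Network M T) {s : State M} {x : SlotRecord M}
    {i : Fin M} (he : s.elapsed < T) (h1 : 1 ≤ s.age i) (hi : i ∉ deliveredAfter s x) :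
    potential N (slotStep T s x) i = remainingCost N
      (Finset.univ.filter fun k => k ∉ deliveredAfter s x ∧ s.age i ≤ s.age k)
      (slotAge T s i + 1) := by
  rw [potential, if_neg (notMem_delivered_slotStep hi), ahead_slotStep hi h1,
    slotAge_slotStep hi he, Nat.cast_add, Nat.cast_one]

/-- Sum of the ages so far plus the potential, compensated by the cost of the completed cycles. -/
noncomputable def compensatedAge (N : Network M T) (h₁ : Fin M → ℕ) (i : Fin M)
    (w : History M) : ℝ :=
  T * ageSum T h₁ i w + potential N (stateAfter T h₁ w) i - cycleCost N * deliveries i w -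
    T * w.length

/-- While i waits, the age paid in the slot is at most the drop in `remainingCost`, apart from the
growth T of the reserve, which the term `T * w.length` absorbs. At the delivery `cycleCost` finances
the next cycle, and until the frame ends the potential pays T·age per slot. -/
theorem stepMean_compensatedAge_le {N : Network M T} {h₁ : Fin M → ℕ} {G : Policy M}
    (hT : 0 < T) (hh : ∀ i, 1 ≤ h₁ i) (hG : IsGreedy T h₁ G) (i : Fin M) (w : History M) :
    stepMean N G (compensatedAge N h₁ i) w ≤ compensatedAge N h₁ i w := by
  have hage := one_le_age (T := T) hh w i
  have hel := elapsed_lt hT h₁ w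
  have hc := cycleCost_nonneg N
  have hT' : (0 : ℝ) ≤ T := Nat.cast_nonneg T
  refine stepMean_le_of_support fun a ha => ?_
  have hgr := hG w
  have hZ : ∀ x, compensatedAge N h₁ i (w ++ [x]) = T * ageSum T h₁ i w +
      T * (stateAfter T h₁ w).age i + potential N (slotStep T (stateAfter T h₁ w) x) i -
      cycleCost N * deliveries i (w ++ [x]) - T * w.length - T := by
    intro x
    rw [compensatedAge, ageSum_snoc, stateAfter_snoc, List.length_append, List.length_singleton]
    push_cast
    ring
  generalize hs : stateAfter T h₁ w = s at *
  by_cases hi : i ∈ s.delivered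
  · have key : ∀ x, compensatedAge N h₁ i (w ++ [x]) ≤ compensatedAge N h₁ i w := by
      intro x
      have hx : i ∈ deliveredAfter s x := by
        rcases x with ⟨_ | j, _ | _⟩ <;> simp [deliveredAfter, hi]
      have h1 := potential_slotStep_of_mem N hel hx
      have h2 : (deliveries i w : ℝ) ≤ deliveries i (w ++ [x]) := by
        rw [deliveries_snoc]
        exact_mod_cast Nat.le_add_right _ _
      have h3 := mul_le_mul_of_nonneg_left h2 hc
      have hpot : potential N s i = (T - s.elapsed) * (T * s.age i) + cycleCost N := if_pos hi
      rw [hZ, compensatedAge, hs, hpot]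
      linarith
    calc _ ≤ ∑ b, (feedback N a b).toReal * compensatedAge N h₁ i w :=
          Finset.sum_le_sum fun b _ => mul_le_mul_of_nonneg_left (key _) ENNReal.toReal_nonneg
      _ = _ := by rw [← Finset.sum_mul, sum_toReal_eq_one, one_mul]
  · rcases a with _ | j
    · exact absurd (hgr.2 ha i) hi
    · obtain ⟨hj, hmax⟩ := hgr.1 j ha
      have hji := hmax i hi
      have hjR : j ∈ ahead s i := by simp [ahead, hj, hji]
      have hatt := remainingCost_attempt N hjR (slotAge T s i)
      have hfalse : potential N (slotStep T s (some j, false)) i =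
          remainingCost N (ahead s i) (slotAge T s i + 1) :=
        potential_slotStep_of_notMem N hel hage hi
      have htrue : potential N (slotStep T s (some j, true)) i -
          cycleCost N * (if ((some j, true) : SlotRecord M) = (some i, true) then 1 else 0 : ℕ) ≤
          remainingCost N ((ahead s i).erase j) (slotAge T s i + 1) := by
        by_cases hij : i = j
        · subst hij
          have hi' : i ∈ deliveredAfter s (some i, true) := Finset.mem_insert_self i s.delivered
          have h1 := potential_slotStep_of_mem N hel hi'
          have h2 := mul_le_remainingCost N ((ahead s i).erase i)
            (a := (slotAge T s i : ℝ) + 1) (by positivity)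
          -- The reserve covers the ages of the remaining slots of the frame.
          have h3 : ((T : ℝ) - s.elapsed - 1) * (T * s.age i) ≤ (slotAge T s i + 1) * T := by
            rw [slotAge]
            push_cast
            have e0 : (0 : ℝ) ≤ s.elapsed := Nat.cast_nonneg _
            have e1 : (0 : ℝ) ≤ (s.elapsed + 1) * (T * s.age i) := by positivity
            have e2 : (0 : ℝ) ≤ (s.elapsed + 1) * T := by positivity
            nlinarith
          simp only [if_true, Nat.cast_one, mul_one]
          linarith
        · have hne : ((some j, true) : SlotRecord M) ≠ (some i, true) := by
            simpa using fun h => hij h.symm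
          have hi' : i ∉ deliveredAfter s (some j, true) := by simp [deliveredAfter, hij, hi]
          rw [if_neg hne, Nat.cast_zero, mul_zero, sub_zero,
            potential_slotStep_of_notMem N hel hage hi']
          -- A success removes exactly the served client from the set ahead of i.
          have hR : (Finset.univ.filter fun k => k ∉ deliveredAfter s (some j, true) ∧
              s.age i ≤ s.age k) = (ahead s i).erase j := by
            ext k
            simp only [deliveredAfter, ahead, Finset.mem_filter, Finset.mem_univ, true_and,
              Finset.mem_insert, Finset.mem_erase]
            tauto
          rw [hR]
      have htrue' := mul_le_mul_of_nonneg_left htrue (N.p_pos j).le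
      have hsa : (T : ℝ) * s.age i ≤ slotAge T s i := by
        rw [slotAge]
        push_cast
        linarith [(Nat.cast_nonneg s.elapsed : (0 : ℝ) ≤ s.elapsed)]
      have hpot : potential N s i = remainingCost N (ahead s i) (slotAge T s i) := if_neg hi
      rw [sum_feedback_some, hZ, hZ, hfalse, deliveries_snoc, deliveries_snoc, compensatedAge, hs,
        hpot]
      simp only [Prod.mk.injEq, Bool.false_eq_true, and_false, if_false, Nat.cast_add,
        add_zero] at htrue' ⊢
      linarith

/-- Expected sum of the ages of a client under Greedy. -/
theorem mean_ageSum_le {N : Network M T} {h₁ : Fin M → ℕ} {G : Policy M} (hT : 0 < T)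
    (hTM : T < M) (hh : ∀ i, 1 ≤ h₁ i) (hG : IsGreedy T h₁ G) (i : Fin M) (t : ℕ) :
    T * mean N G t (fun w => (ageSum T h₁ i w : ℝ)) ≤
      potential N (stateAfter T h₁ []) i +
        cycleCost N * ((t * (M + T) / (∑ j, 1 / N.p j) + 2 * M) / (M - T)) + T * t := by
  have h1 := mean_le_of_stepMean_le (fun w (_ : IsPath N G w) =>
    stepMean_compensatedAge_le (N := N) hT hh hG i w) t
  have h2 : mean N G t (((T : ℝ) • fun w => (ageSum T h₁ i w : ℝ)) -
      (cycleCost N • fun w => (deliveries i w : ℝ)) - fun _ => (T : ℝ) * t) ≤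
      mean N G t (compensatedAge N h₁ i) := by
    refine mean_mono fun w _ hl => ?_
    have := potential_nonneg N (elapsed_lt hT h₁ w) i
    simp only [Pi.sub_apply, Pi.smul_apply, smul_eq_mul, compensatedAge, hl]
    linarith
  rw [map_sub, map_sub, map_smul, map_smul, mean_const, smul_eq_mul, smul_eq_mul] at h2
  have h3 := mul_le_mul_of_nonneg_left (mean_deliveries_le (N := N) hT hTM hh hG i t)
    (cycleCost_nonneg N)
  have h4 : compensatedAge N h₁ i [] = potential N (stateAfter T h₁ []) i := by
    simp [compensatedAge, ageSum, deliveries]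
  linarith

/-! ### Lower bound for every policy -/

/-- Sample path bound: the ages are small only if there are many deliveries. -/
theorem le_ageSum (hT : 0 < T) (h₁ : Fin M → ℕ) (i : Fin M) (x : ℝ) (w : History M) :
    (1 + 2 * x) * w.length - T * x ^ 2 * deliveries i w +
      T * ((((stateAfter T h₁ w).age i : ℝ) - 1) ^ 2 -
        2 * x * (((stateAfter T h₁ w).age i : ℝ) - 1)) +
      (if i ∈ (stateAfter T h₁ w).delivered then T * x ^ 2 else 0) +
      (stateAfter T h₁ w).elapsed * (2 * (stateAfter T h₁ w).age i - 1 - 2 * x) ≤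
    2 * ageSum T h₁ i w + T * (((h₁ i : ℝ) - 1) ^ 2 - 2 * x * ((h₁ i : ℝ) - 1)) := by
  induction w using List.reverseRecOn with
  | nil => simp [stateAfter, deliveries, ageSum]
  | append_singleton w y ih =>
    have hel := elapsed_lt hT h₁ w
    have hT' : (0 : ℝ) ≤ T := Nat.cast_nonneg T
    rw [ageSum_snoc, stateAfter_snoc, List.length_append, List.length_singleton]
    generalize hs : stateAfter T h₁ w = s at *
    have hx : 0 ≤ T * x ^ 2 := by positivity
    -- The charge T·x² of a delivery is held by the indicator until the frame ends.
    have hdel : (if i ∈ deliveredAfter s y then T * x ^ 2 else 0) -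
        T * x ^ 2 * deliveries i (w ++ [y]) ≤
        (if i ∈ s.delivered then T * x ^ 2 else 0) - T * x ^ 2 * deliveries i w := by
      rw [deliveries_snoc]
      by_cases hy : y = (some i, true)
      · subst hy
        have hi' : i ∈ deliveredAfter s (some i, true) := Finset.mem_insert_self i s.delivered
        rw [if_pos hi', if_pos rfl]
        push_cast
        split_ifs <;> linarith
      · have : i ∈ deliveredAfter s y ↔ i ∈ s.delivered := by
          rcases y with ⟨_ | j, _ | _⟩ <;> simp [deliveredAfter]
          rintro rfl
          exact absurd rfl hy
        simp [this, hy]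
    rcases Nat.lt_or_ge (s.elapsed + 1) T with h | h
    · rw [slotStep_of_lt h]
      push_cast
      linarith
    · have h : s.elapsed + 1 = T := by omega
      have h' : (s.elapsed : ℝ) = T - 1 := by
        rw [← h]
        push_cast
        ring
      rw [h'] at ih
      rw [slotStep_of_eq h]
      by_cases hi : i ∈ deliveredAfter s y
      · simp only [hi, if_true, Finset.notMem_empty, if_false, Nat.cast_one, Nat.cast_zero,
          Nat.cast_add] at hdel ⊢
        -- The only loss per cycle: a gap of h frames loses T(h - x)², the distance of the parabola
        -- from its tangent at x.
        have := mul_nonneg hT' (sq_nonneg ((s.age i : ℝ) - x))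
        linarith
      · simp only [hi, Finset.notMem_empty, if_false, Nat.cast_one, Nat.cast_zero,
          Nat.cast_add] at hdel ⊢
        linarith

/-- `√(α / p)` summed over the clients. -/
noncomputable def sumSqrt (N : Network M T) : ℝ := ∑ i, Real.sqrt (N.α i / N.p i)

/-- Expected weighted sum of ages, for every policy. -/
theorem exists_le_mean_ageSum (hT : 0 < T) (N : Network M T) (h₁ : Fin M → ℕ) :
    ∃ C : ℝ, ∀ (π : Policy M) (K : ℕ),
      (sumSqrt N ^ 2 / T + ∑ i, N.α i) / 2 * (K * T) - C ≤
        mean N π (K * T) (fun w => ∑ i, N.α i * ageSum T h₁ i w) := by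
  have hT' : (0 : ℝ) < T := Nat.cast_pos.2 hT
  set B := sumSqrt N with hB
  -- Here x_i = B/(T√(α_i p_i)), so that α_i x_i² is a common constant divided by p_i: the
  -- subtracted delivery terms become a multiple of the sum of D_i/p_i.
  let x : Fin M → ℝ := fun i => B / T * (Real.sqrt (N.α i / N.p i) / N.α i)
  have hx1 : ∀ i, N.α i * x i = B / T * Real.sqrt (N.α i / N.p i) := fun i => by
    have := (N.α_pos i).ne'
    simp only [x]
    field_simp
  have hx2 : ∀ i, N.α i * x i ^ 2 = (B / T) ^ 2 / N.p i := fun i => by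
    have h1 := (N.α_pos i).ne'
    have h2 := (N.p_pos i).ne'
    have h3 := Real.sq_sqrt (div_pos (N.α_pos i) (N.p_pos i)).le
    simp only [x, mul_pow, div_pow, h3]
    field_simp
  let c : Fin M → ℝ := fun i =>
    T * x i ^ 2 + T * (((h₁ i : ℝ) - 1) ^ 2 - 2 * x i * ((h₁ i : ℝ) - 1))
  refine ⟨(∑ i, N.α i * c i) / 2, fun π K => ?_⟩
  have key : mean N π (K * T) ((fun _ => (∑ i, N.α i * (1 + 2 * x i)) * (K * T) -
      ∑ i, N.α i * c i) - ((T * (B / T) ^ 2) • fun w => ∑ j, (deliveries j w : ℝ) / N.p j)) ≤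
      mean N π (K * T) ((2 : ℝ) • fun w => ∑ i, N.α i * (ageSum T h₁ i w : ℝ)) := by
    refine mean_mono fun w _ hl => ?_
    simp only [Pi.sub_apply, Pi.smul_apply, smul_eq_mul, Finset.mul_sum, Finset.sum_mul,
      ← Finset.sum_sub_distrib]
    refine Finset.sum_le_sum fun i _ => ?_
    have h1 := le_ageSum hT h₁ i (x i) w
    have h2 := elapsed_stateAfter hT h₁ w
    rw [hl, Nat.mul_mod_left] at h2
    rw [h2, hl] at h1
    push_cast at h1
    have h3 : 0 ≤ (if i ∈ (stateAfter T h₁ w).delivered then T * x i ^ 2 else 0) := by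
      split_ifs
      · positivity
      · exact le_rfl
    -- The unfinished last gap may contribute negatively, but by at most T·x_i², which is included
    -- in `c`.
    have h4 := mul_nonneg hT'.le (sq_nonneg ((stateAfter T h₁ w).age i - 1 - x i))
    have h5 : (1 + 2 * x i) * (K * T) - T * x i ^ 2 * deliveries i w - c i ≤
        2 * ageSum T h₁ i w := by
      simp only [c]
      linarith
    have h6 := mul_le_mul_of_nonneg_left h5 (N.α_pos i).le
    calc _ = N.α i * (1 + 2 * x i) * (K * T) - N.α i * c i -
          T * ((B / T) ^ 2 / N.p i) * deliveries i w := by ring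
      _ = N.α i * ((1 + 2 * x i) * (K * T) - T * x i ^ 2 * deliveries i w - c i) := by
        rw [← hx2]
        ring
      _ ≤ _ := h6
      _ = _ := by ring
  rw [map_sub, map_smul, map_smul, mean_const, smul_eq_mul, smul_eq_mul] at key
  have h1 := mul_le_mul_of_nonneg_left (mean_sum_deliveries_le N π (K * T))
    (by positivity : 0 ≤ T * (B / T) ^ 2)
  have h2 : ∑ i, N.α i * (1 + 2 * x i) = (∑ i, N.α i) + 2 * (B ^ 2 / T) := by
    have : ∀ i, N.α i * (1 + 2 * x i) =
        N.α i + 2 * (B / T) * Real.sqrt (N.α i / N.p i) := fun i => by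
      rw [mul_add, mul_one, mul_left_comm, hx1]
      ring
    simp only [this, Finset.sum_add_distrib, ← Finset.mul_sum]
    rw [← sumSqrt, ← hB]
    ring
  have h3 : (T : ℝ) * (B / T) ^ 2 = B ^ 2 / T := by
    field_simp
  rw [h2] at key
  rw [h3] at key h1
  push_cast at h1
  linarith

/-! ### From age sums to long-run costs -/

theorem cost_nonneg (N : Network M T) (h₁ : Fin M → ℕ) (K : ℕ) (w : History M) :
    0 ≤ cost N h₁ K w := by
  refine mul_nonneg (by positivity) (Finset.sum_nonneg fun k _ => Finset.sum_nonneg fun i _ =>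
    mul_nonneg (N.α_pos i).le (Nat.cast_nonneg _))

theorem expectedCost_eq (N : Network M T) (h₁ : Fin M → ℕ) (π : Policy M) (K : ℕ) :
    expectedCost N h₁ π K = ENNReal.ofReal (mean N π (K * T) (cost N h₁ K)) :=
  tsum_law_mul_ofReal N π _ _ (cost_nonneg N h₁ K)

theorem cost_eq (hT : 0 < T) (N : Network M T) (h₁ : Fin M → ℕ) (K : ℕ) {w : History M}
    (hw : w.length = K * T) :
    cost N h₁ K w = 1 / (K * M * T) * ∑ i, N.α i * ageSum T h₁ i w := by
  have hT' : (T : ℝ) ≠ 0 := Nat.cast_ne_zero.2 hT.ne'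
  rw [cost, Finset.sum_comm]
  simp only [ageSum_eq hT h₁ _ w K hw, Nat.cast_mul, Nat.cast_sum, ← Finset.mul_sum]
  rw [Finset.sum_congr rfl fun i _ => mul_left_comm (N.α i) (T : ℝ) _, ← Finset.mul_sum,
    ← mul_assoc]
  congr 1
  field_simp

theorem mean_cost_eq (hT : 0 < T) (N : Network M T) (h₁ : Fin M → ℕ) (π : Policy M) (K : ℕ) :
    mean N π (K * T) (cost N h₁ K) = 1 / (K * M * T) *
      mean N π (K * T) (fun w => ∑ i, N.α i * ageSum T h₁ i w) := by
  rw [← smul_eq_mul (a := 1 / ((K : ℝ) * M * T)), ← map_smul]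
  exact le_antisymm (mean_mono fun w _ hl => (cost_eq hT N h₁ K hl).le)
    (mean_mono fun w _ hl => (cost_eq hT N h₁ K hl).ge)

/-- Asymptotic bound for the expected cost of Greedy. -/
noncomputable def greedyBound (N : Network M T) : ℝ :=
  (∑ i, N.α i) / M * (cycleCost N * (M + T) / ((∑ j, 1 / N.p j) * (M - T) * T) + 1)

theorem limsup_expectedCost_le {N : Network M T} {h₁ : Fin M → ℕ} {G : Policy M} (hT : 0 < T)
    (hTM : T < M) (hh : ∀ i, 1 ≤ h₁ i) (hG : IsGreedy T h₁ G) :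
    Filter.limsup (fun K => expectedCost N h₁ G K) Filter.atTop ≤
      ENNReal.ofReal (greedyBound N) := by
  have hT' : (0 : ℝ) < T := Nat.cast_pos.2 hT
  have hM' : (0 : ℝ) < M := Nat.cast_pos.2 (hT.trans hTM)
  have hMT : (0 : ℝ) < M - T := sub_pos.2 (by exact_mod_cast hTM)
  have hS : 0 < ∑ j, 1 / N.p j :=
    Finset.sum_pos (fun j _ => one_div_pos.2 (N.p_pos j)) ⟨⟨0, hT.trans hTM⟩, Finset.mem_univ _⟩
  -- Collects the initial potentials and the additive 2M in the delivery counts; its contribution is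
  -- C/K.
  set C : ℝ := (∑ i, N.α i * (potential N (stateAfter T h₁ []) i +
    cycleCost N * (2 * M / (M - T)))) / (M * T ^ 2) with hC
  have hle : ∀ K : ℕ, 0 < K → expectedCost N h₁ G K ≤
      ENNReal.ofReal (greedyBound N + C / K) := by
    intro K hK
    have hK' : (0 : ℝ) < K := Nat.cast_pos.2 hK
    rw [expectedCost_eq, mean_cost_eq hT]
    refine ENNReal.ofReal_le_ofReal ?_
    have h1 : mean N G (K * T) (fun w => ∑ i, N.α i * (ageSum T h₁ i w : ℝ)) =
        ∑ i, N.α i * mean N G (K * T) (fun w => (ageSum T h₁ i w : ℝ)) := by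
      have : (fun w : History M => ∑ i, N.α i * (ageSum T h₁ i w : ℝ)) =
          ∑ i, N.α i • fun w => (ageSum T h₁ i w : ℝ) := by
        funext w
        simp
      rw [this, map_sum]
      simp
    have h2 : T * ∑ i, N.α i * mean N G (K * T) (fun w => (ageSum T h₁ i w : ℝ)) ≤
        ∑ i, N.α i * (potential N (stateAfter T h₁ []) i + cycleCost N * (2 * M / (M - T))) +
        (∑ i, N.α i) * (cycleCost N * (K * T * (M + T) / ((∑ j, 1 / N.p j) * (M - T))) +
          T * (K * T)) := by
      rw [Finset.mul_sum, Finset.sum_mul, ← Finset.sum_add_distrib]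
      refine Finset.sum_le_sum fun i _ => ?_
      have := mul_le_mul_of_nonneg_left
        (mean_ageSum_le (N := N) hT hTM hh hG i (K * T)) (N.α_pos i).le
      push_cast at this
      calc _ = N.α i * (T * mean N G (K * T) (fun w => (ageSum T h₁ i w : ℝ))) := by ring
        _ ≤ _ := this
        _ = _ := by
          field_simp
          ring
    rw [h1]
    have h3 := mul_le_mul_of_nonneg_left h2 (by positivity : 0 ≤ 1 / ((K : ℝ) * M * T ^ 2))
    calc _ = 1 / ((K : ℝ) * M * T ^ 2) *
          (T * ∑ i, N.α i * mean N G (K * T) (fun w => (ageSum T h₁ i w : ℝ))) := by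
          field_simp
      _ ≤ _ := h3
      _ = _ := by
        rw [hC, greedyBound]
        generalize ∑ i, N.α i * (potential N (stateAfter T h₁ []) i +
          cycleCost N * (2 * M / (M - T))) = C₀
        generalize (∑ j, 1 / N.p j) = S at hS
        field_simp
        ring
  have htend : Filter.Tendsto (fun K : ℕ => ENNReal.ofReal (greedyBound N + C / K)) Filter.atTop
      (nhds (ENNReal.ofReal (greedyBound N))) := by
    refine ENNReal.tendsto_ofReal ?_
    simpa using (tendsto_const_div_atTop_nhds_zero_nat C).const_add (greedyBound N)
  rw [← htend.limsup_eq]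
  refine Filter.limsup_le_limsup ?_
  filter_upwards [Filter.eventually_gt_atTop 0] with K hK using hle K hK

/-- Asymptotic lower bound for the expected cost of every policy. -/
noncomputable def optimalBound (N : Network M T) : ℝ :=
  (sumSqrt N ^ 2 + T * ∑ i, N.α i) / (2 * T * M)

theorem le_liminf_optimalCost (hT : 0 < T) (hM : 0 < M) (N : Network M T) (h₁ : Fin M → ℕ) :
    ENNReal.ofReal (optimalBound N) ≤
      Filter.liminf (fun K => optimalCost N h₁ K) Filter.atTop := by
  have hT' : (0 : ℝ) < T := Nat.cast_pos.2 hT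
  have hM' : (0 : ℝ) < M := Nat.cast_pos.2 hM
  obtain ⟨C, hC⟩ := exists_le_mean_ageSum hT N h₁
  have hle : ∀ K : ℕ, 0 < K →
      ENNReal.ofReal (optimalBound N - C / (M * T) / K) ≤ optimalCost N h₁ K := by
    intro K hK
    have hK' : (0 : ℝ) < K := Nat.cast_pos.2 hK
    refine le_iInf fun η => ?_
    rw [expectedCost_eq, mean_cost_eq hT]
    refine ENNReal.ofReal_le_ofReal ?_
    refine le_trans (le_of_eq ?_) (mul_le_mul_of_nonneg_left (hC η.1 K) (by positivity))
    rw [optimalBound]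
    field_simp
  have htend : Filter.Tendsto (fun K : ℕ => ENNReal.ofReal (optimalBound N - C / (M * T) / K))
      Filter.atTop (nhds (ENNReal.ofReal (optimalBound N))) := by
    refine ENNReal.tendsto_ofReal ?_
    simpa using (tendsto_const_div_atTop_nhds_zero_nat (C / (M * T))).const_sub (optimalBound N)
  rw [← htend.liminf_eq]
  refine Filter.liminf_le_liminf ?_
  filter_upwards [Filter.eventually_gt_atTop 0] with K hK using hle K hK

/-! ### Comparison of the two bounds -/

/-- Since C_V² = MQ/S² - 1, this exhibits in ρ^G the quantity S + Q/S that comes from `cycleCost`,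
short of it by S/M. -/
theorem sum_mul_one_add_coeffVar (hM : 0 < M) (N : Network M T) :
    (∑ j, 1 / N.p j) * (1 + coeffVar N ^ 2 / M) =
      (∑ j, 1 / N.p j) * (1 - 1 / M) + (∑ j, (1 / N.p j) ^ 2) / ∑ j, 1 / N.p j := by
  have hM' : (0 : ℝ) < M := Nat.cast_pos.2 hM
  have hS : 0 < ∑ j, 1 / N.p j :=
    Finset.sum_pos (fun j _ => one_div_pos.2 (N.p_pos j)) ⟨⟨0, hM⟩, Finset.mem_univ _⟩
  have hV : 0 ≤ varInv N :=
    mul_nonneg (by positivity) (Finset.sum_nonneg fun _ _ => sq_nonneg _)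
  have hV' : varInv N = 1 / M * (∑ j, (1 / N.p j) ^ 2) - meanInv N ^ 2 := by
    have h1 : ∀ j, (1 / N.p j - meanInv N) ^ 2 =
        (1 / N.p j) ^ 2 - 2 * meanInv N * (1 / N.p j) + meanInv N ^ 2 := fun j => by ring
    rw [varInv, Finset.sum_congr rfl fun j _ => h1 j, Finset.sum_add_distrib,
      Finset.sum_sub_distrib, ← Finset.mul_sum, Finset.sum_const, Finset.card_univ,
      Fintype.card_fin, nsmul_eq_mul, meanInv]
    field_simp
    ring
  rw [coeffVar, div_pow, Real.sq_sqrt hV, hV', meanInv]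
  generalize (∑ j, 1 / N.p j) = S at *
  field_simp
  ring

/-- Relative excess of the bound for Greedy, with `y = 1 / M`. -/
noncomputable def excess (T : ℕ) (y : ℝ) : ℝ :=
  (1 + T * y) / (1 - T * y) * (2 * T * y * (1 + T * y) + 1 / (1 - y)) + 2 * T * y

theorem tendsto_excess (T : ℕ) :
    Filter.Tendsto (fun M : ℕ => excess T (1 / M)) Filter.atTop (nhds 1) := by
  have h : ContinuousAt (excess T) 0 := by
    unfold excess
    refine ContinuousAt.add (ContinuousAt.mul (ContinuousAt.div (by fun_prop) (by fun_prop)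
      (by simp)) (ContinuousAt.add (by fun_prop) (ContinuousAt.div (by fun_prop) (by fun_prop)
      (by simp)))) (by fun_prop)
  have h0 : excess T 0 = 1 := by simp [excess]
  rw [ContinuousAt, h0] at h
  exact h.comp tendsto_one_div_atTop_nhds_zero_nat

/-- The denominator of `rhoGreedy` cancels against `optimalBound`, leaving the claim `h4`. About p
it needs only S ≥ M, that is p ≤ 1, so the threshold for M depends on T and ε alone. -/
theorem greedyBound_le (hT : 0 < T) (hTM : T < M) {ε : ℝ} (hε : 0 < ε)
    (hM : excess T (1 / M) ≤ 1 + ε) (N : Network M T) :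
    greedyBound N ≤ (1 + ε) * rhoGreedy N * optimalBound N := by
  have hT' : (0 : ℝ) < T := Nat.cast_pos.2 hT
  have hM0 : 0 < M := hT.trans hTM
  have hM' : (0 : ℝ) < M := Nat.cast_pos.2 hM0
  have hMT : (0 : ℝ) < M - T := sub_pos.2 (by exact_mod_cast hTM)
  have hM1 : (0 : ℝ) < M - 1 := sub_pos.2 (by exact_mod_cast (by omega : 1 < M))
  have hSM : (M : ℝ) ≤ ∑ j, 1 / N.p j := by
    calc (M : ℝ) = ∑ _j : Fin M, (1 : ℝ) := by simp
      _ ≤ _ := Finset.sum_le_sum fun j _ => (one_le_div (N.p_pos j)).2 (N.p_le_one j)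
  have hα : 0 < ∑ i, N.α i := Finset.sum_pos (fun i _ => N.α_pos i) ⟨⟨0, hM0⟩, Finset.mem_univ _⟩
  have hX := sum_mul_one_add_coeffVar hM0 N
  set X := (∑ j, 1 / N.p j) * (1 + coeffVar N ^ 2 / M) with hXdef
  have hQ := sum_one_div_sq_nonneg N Finset.univ
  have hSX : ∑ j, 1 / N.p j ≤ X := by
    rw [hXdef]
    refine le_mul_of_one_le_right (hM'.le.trans hSM) ?_
    have : 0 ≤ coeffVar N ^ 2 / M := by positivity
    linarith
  rw [greedyBound, rhoGreedy, optimalBound, cycleCost, mul_assoc (∑ i, N.α i), ← hXdef, ← sumSqrt]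
  generalize (∑ j, 1 / N.p j) = S at *
  generalize (∑ j, (1 / N.p j) ^ 2) = Q at *
  generalize (∑ i, N.α i) = A at *
  have hS : 0 < S := hM'.trans_le hSM
  have hD : 0 < sumSqrt N ^ 2 + T * A := by positivity
  have hX0 : 0 < X := hS.trans_le hSX
  have h1 : S + Q / S ≤ X * (1 / (1 - 1 / M)) := by
    have : 0 < 1 - 1 / (M : ℝ) := by
      rw [sub_pos, div_lt_one hM']
      linarith
    rw [mul_one_div, le_div_iff₀ this, hX]
    have h2 : 0 ≤ Q / S * (1 / M) := by positivity
    linarith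
  -- Used to convert additive terms of size T into multiples of X of size T/M.
  have h2 : 1 ≤ X * (1 / M) := by
    rw [mul_one_div, one_le_div hM']
    linarith
  have h3 : T / S ≤ T * (1 / M) := by
    rw [mul_one_div]
    gcongr
  have hr : (0 : ℝ) ≤ (M + T) / (M - T) := by positivity
  have h4 : (M + T) / (M - T) * (2 * T * (1 + T / S) + (S + Q / S)) + 2 * T ≤
      (1 + ε) * (X + T) := by
    have e1 : 2 * T * (1 + T / S) ≤ X * (2 * T * (1 / M) * (1 + T * (1 / M))) := by
      calc 2 * T * (1 + T / S) ≤ 2 * T * (1 + T * (1 / M)) := by gcongr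
        _ ≤ (2 * T * (1 + T * (1 / M))) * (X * (1 / M)) :=
          le_mul_of_one_le_right (by positivity) h2
        _ = _ := by ring
    have e2 : (2 * T : ℝ) ≤ X * (2 * T * (1 / M)) := by
      calc (2 * T : ℝ) ≤ 2 * T * (X * (1 / M)) := le_mul_of_one_le_right (by positivity) h2
        _ = _ := by ring
    have e3 : ((M : ℝ) + T) / (M - T) = (1 + T * (1 / M)) / (1 - T * (1 / M)) := by
      field_simp
    have e4 := mul_le_mul_of_nonneg_left (add_le_add e1 h1) hr
    have e5 := mul_le_mul_of_nonneg_left hM hX0.le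
    have e6 : 0 ≤ (1 + ε) * T := by positivity
    rw [excess, ← e3] at e5
    linarith
  calc _ = A / (2 * T * M) *
        ((M + T) / (M - T) * (2 * T * (1 + T / S) + (S + Q / S)) + 2 * T) := by
        field_simp
    _ ≤ A / (2 * T * M) * ((1 + ε) * (X + T)) := by gcongr
    _ = _ := by
      field_simp

end AoI

theorem mainTheorem8 (T : ℕ) (hT : 0 < T) (ε : ℝ) (hε : 0 < ε) :
    ∀ᶠ M : ℕ in Filter.atTop,
      ∀ (N : AoI.Network M T) (h₁ : Fin M → ℕ), (∀ i, 1 ≤ h₁ i) →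
        ∀ G : AoI.Policy M, AoI.IsGreedy T h₁ G →
          AoI.optimalityRatio N h₁ G ≤ ENNReal.ofReal ((1 + ε) * AoI.rhoGreedy N) := by
  filter_upwards [Filter.eventually_gt_atTop T, (AoI.tendsto_excess T).eventually_le_const
    (by linarith : (1 : ℝ) < 1 + ε)] with M hTM hM N h₁ hh G hG
  have hα : 0 < ∑ i, N.α i :=
    Finset.sum_pos (fun i _ => N.α_pos i) ⟨⟨0, hT.trans hTM⟩, Finset.mem_univ _⟩
  have hT' : (0 : ℝ) < T := Nat.cast_pos.2 hT
  have hM' : (0 : ℝ) < M := Nat.cast_pos.2 (hT.trans hTM)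
  have hopt : 0 < AoI.optimalBound N := by
    rw [AoI.optimalBound]
    positivity
  have hle := AoI.greedyBound_le hT hTM hε hM N
  calc AoI.optimalityRatio N h₁ G
      ≤ ENNReal.ofReal (AoI.greedyBound N) / ENNReal.ofReal (AoI.optimalBound N) :=
        ENNReal.div_le_div (AoI.limsup_expectedCost_le hT hTM hh hG)
          (AoI.le_liminf_optimalCost hT (hT.trans hTM) N h₁)
    _ = ENNReal.ofReal (AoI.greedyBound N / AoI.optimalBound N) :=
        (ENNReal.ofReal_div_of_pos hopt).symm
    _ ≤ _ := ENNReal.ofReal_le_ofReal ((div_le_iff₀ hopt).2 hle)
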